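/- For a finite set $V\subset\mathbb R^d$ and a graph $G=(V,E)$, every edge is weighted by the Euclidean distance of its endpoints. For $S\subseteq V$ let $G\setminus S$ be the subgraph of $G$ induced by $V\setminus S$. A graph is a $t$-spanner of a set $A$ of its vertices if any two points $x,y\in A$ are joined in it by a path of length at most $t\|xy\|$. For a function $f$, the graph $G$ is an $f(k,n)$-hardy $t$-spanner of $V$ if for every $S\subseteq V$ there is a set $S^+$ with $S\subseteq S^+\subseteq V$ and $|S^+|\le f(|S|,|V|)$ such that $G\setminus S$ is a $t$-spanner of $V\setminus S^+$. **Theorem.** Let $d\ge 1$, let $f:\mathbb N\times\mathbb N\to\mathbb R$ and $s:\mathbb N\to[1,\infty)$ be functions, and let $1\le t_0\le t$, where $t_0<t$ is required if $d\ge 2$ (for $d=1$ the case $t_0=t$ is allowed). Suppose that $f(k,n)$-hardy $t_0$-spanners with $O(n\cdot s(n))$ edges exist for all finite $V\subset\mathbb R^d$; that is, there is a constant $C$ such that every finite $V\subset\mathbb R^d$, with $n=|V|$, has an $f(k,n)$-hardy $t_0$-spanner with at most $C\,n\,s(n)$ edges. Then $O(f(k,n)\cdot s(n))$-hardy $t$-spanners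 with $O(n)$ edges exist for all finite $V\subset\mathbb R^d$; that is, there are constants $c,C'>0$, independent of $V$, such that every finite $V\subset\mathbb R^d$, with $n=|V|$, has a $c\,f(k,n)\,s(n)$-hardy $t$-spanner with at most $C'n$ edges. -/

import Mathlib

noncomputable section

/-- The length of a walk in a graph whose vertices are points of a metric space:
every edge weighs the distance between its endpoints. -/
def walkLength {α : Type*} [PseudoMetricSpace α] {G : SimpleGraph α} {x y : α}
    (w : G.Walk x y) : ℝ :=
  (w.darts.map fun e => dist e.fst e.snd).sum

/-- `G` is a geometric `t`-spanner of the set `A` of its vertices: any two points `x, y` of `A`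
are joined in `G` by a path of length at most `t` times their distance
(for the finite graphs used below, this says that the shortest path is at most that long;
for `x = y` the empty path does). -/
def IsSpannerOn {α : Type*} [PseudoMetricSpace α] (t : ℝ) (G : SimpleGraph α) (A : Set α) : Prop :=
  ∀ x ∈ A, ∀ y ∈ A, ∃ w : G.Walk x y, walkLength w ≤ t * dist x y

/-- `G` is an `f(k,n)`-hardy `t`-spanner: for every set `S` of vertices there is `S⁺ ⊇ S` with
`|S⁺| ≤ f(|S|, |V|)` such that `G ∖ S` (the subgraph induced on the complement of `S`) is a
`t`-spanner of the vertices outside `S⁺`. -/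
def IsHardySpanner {α : Type*} [PseudoMetricSpace α] [Fintype α]
    (f : ℕ → ℕ → ℝ) (t : ℝ) (G : SimpleGraph α) : Prop :=
  ∀ S : Finset α, ∃ S' : Finset α, S ⊆ S' ∧ (S'.card : ℝ) ≤ f S.card (Fintype.card α) ∧
    IsSpannerOn t (G.induce (S : Set α)ᶜ) {v | (v : α) ∉ S'}

/-- `f(k,n)`-hardy `t`-spanners with `O(e(n))` edges exist for all finite `V ⊂ ℝ^d`: the constant
`C` is the same for all `V`, and `n = |V|`. -/
def HardySpannersExist (d : ℕ) (t : ℝ) (f : ℕ → ℕ → ℝ) (e : ℕ → ℝ) : Prop :=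
  ∃ C : ℝ, 0 < C ∧ ∀ V : Finset (EuclideanSpace ℝ (Fin d)), ∃ G : SimpleGraph V,
    (G.edgeSet.ncard : ℝ) ≤ C * e V.card ∧ IsHardySpanner f t G

end

/-!
The points are enumerated in a bounded number of orders such that every two points `x`, `y` are
*separated* by one of the orders: of the points between them, those close to `x` come first and
those close to `y` last (`exists_orders`). On the line the natural order has what is needed of this
property without any loss in the stretch, which is why `t = t₀` is possible there. In higher
dimension these are locality-sensitive orders, obtained from shifted quadtrees (`exists_gridKeys`).

In each order, cut the `n` points into groups of about `s(n)` consecutive ones and let the first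
point of each group be its representative. There are about `n / s(n)` representatives, so a hardy
`t₀`-spanner on them has `O(n)` edges. Join every point to the representatives of its own and of
the next group, and put a spanner with linearly many edges, a Yao graph
(`exists_linear_spanner`), on every two consecutive groups. When a set of vertices fails, let the
representatives of their groups fail in the hardy spanner of the representatives; this loses
`f(k,n)` representatives, and the points whose own or next representative is lost are given up, at
most `2 s(n)` points per representative up to rounding. Two remaining points that the order
separates are joined inside two consecutive groups without faults, or else through two
representatives that lie between them, where separation bounds the stretch
(`exists_pairs_of_position`).

Since `f` and `s` are arbitrary functions, the hypothesis says nothing directly about fewer than `n`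
points and fewer than `k` faults. The hardy spanner on the representatives is therefore found in a
hardy spanner of exactly `n` points that consist of many distant copies of the set of
representatives: the cheapest copy has few edges, and the set of faults can be padded outside it
(`exists_pairs_of_card_le`).
-/

namespace HardySpanner

/-! ### Edge sets as finite sets of pairs -/

section Pairs

variable {α : Type*}

/-- The graph on `V` whose edges are the pairs of `P`, made undirected and without loops. -/
def graphOfPairs (V : Finset α) (P : Finset (α × α)) : SimpleGraph V :=
  SimpleGraph.fromRel fun x y => ((x : α), (y : α)) ∈ P

theorem ncard_edgeSet_graphOfPairs_le (V : Finset α) (P : Finset (α × α)) :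
    (graphOfPairs V P).edgeSet.ncard ≤ P.card := by
  classical
  have hinj : Function.Injective (Sym2.map ((↑) : V → α)) :=
    Sym2.map.injective Subtype.val_injective
  rw [← Set.ncard_image_of_injective _ hinj]
  have hsub : Sym2.map ((↑) : V → α) '' (graphOfPairs V P).edgeSet ⊆
      ((P.image fun p => s(p.1, p.2) : Finset (Sym2 α)) : Set (Sym2 α)) := by
    rintro _ ⟨e, he, rfl⟩
    induction e with
    | _ x y =>
      rw [SimpleGraph.mem_edgeSet, graphOfPairs, SimpleGraph.fromRel_adj] at he
      simp only [Sym2.map_mk, Finset.coe_image, Set.mem_image, Finset.mem_coe]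
      rcases he.2 with h | h
      · exact ⟨_, h, rfl⟩
      · exact ⟨_, h, Sym2.eq_swap⟩
  calc _ ≤ _ := Set.ncard_le_ncard hsub (Finset.finite_toSet _)
    _ = _ := Set.ncard_coe_finset _
    _ ≤ _ := Finset.card_image_le

/-- The edges of a graph on `V`, one pair of points for each. -/
theorem exists_pairs (V : Finset α) (G : SimpleGraph V) :
    ∃ P : Finset (α × α), P.card ≤ G.edgeSet.ncard ∧
      ∀ x y : V, G.Adj x y → ((x : α), (y : α)) ∈ P ∨ ((y : α), (x : α)) ∈ P := by
  classical
  refine ⟨G.edgeFinset.image fun e => ((e.out.1 : α), (e.out.2 : α)), ?_, fun x y h => ?_⟩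
  · refine Finset.card_image_le.trans (le_of_eq ?_)
    rw [← SimpleGraph.coe_edgeFinset, Set.ncard_coe_finset]
  · have hout : s((s(x, y)).out.1, (s(x, y)).out.2) = s(x, y) := Quot.out_eq _
    have hmem : (((s(x, y)).out.1 : α), ((s(x, y)).out.2 : α)) ∈
        G.edgeFinset.image fun e => ((e.out.1 : α), (e.out.2 : α)) :=
      Finset.mem_image_of_mem (fun e : Sym2 V => ((e.out.1 : α), (e.out.2 : α)))
        (SimpleGraph.mem_edgeFinset.2 h)
    rcases Sym2.eq_iff.1 hout with ⟨h1, h2⟩ | ⟨h1, h2⟩ <;> rw [h1, h2] at hmem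
    · exact .inl hmem
    · exact .inr hmem

end Pairs

/-! ### Paths avoiding faults -/

section Joined

variable {α : Type*} [PseudoMetricSpace α]

/-- `Joined P A x y L` says that `x` and `y` are joined by a path of length at most `L` all of whose
steps are pairs of `P`, traversed in either direction, between points of `A`. The trivial path does
not require its only point to lie in `A`. -/
inductive Joined (P : Set (α × α)) (A : Set α) : α → α → ℝ → Prop
  | refl (x : α) {L : ℝ} (hL : 0 ≤ L) : Joined P A x x L
  | step {x y z : α} {L L' : ℝ} (h : (x, y) ∈ P ∨ (y, x) ∈ P) (hx : x ∈ A) (hy : y ∈ A)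
      (hyz : Joined P A y z L) (hL : dist x y + L ≤ L') : Joined P A x z L'

namespace Joined

variable {P Q : Set (α × α)} {A B : Set α} {x y z : α} {L L' : ℝ}

theorem nonneg (h : Joined P A x y L) : 0 ≤ L := by
  induction h with
  | refl x hL => exact hL
  | step h hx hy hyz hL ih => linarith [dist_nonneg.trans (le_add_of_nonneg_right ih |>.trans hL)]

theorem mono_length (h : Joined P A x y L) (hL : L ≤ L') : Joined P A x y L' := by
  cases h with
  | refl x h0 => exact .refl x (h0.trans hL)
  | step h hx hy hyz hL' => exact .step h hx hy hyz (hL'.trans hL)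

theorem mono (h : Joined P A x y L) (hP : P ⊆ Q) (hA : A ⊆ B) : Joined Q B x y L := by
  induction h with
  | refl x hL => exact .refl x hL
  | step h hx hy _ hL ih => exact .step (h.imp (@hP _) (@hP _)) (hA hx) (hA hy) ih hL

theorem single (h : (x, y) ∈ P ∨ (y, x) ∈ P) (hx : x ∈ A) (hy : y ∈ A) :
    Joined P A x y (dist x y) :=
  .step h hx hy (.refl y le_rfl) (by simp)

theorem trans (h : Joined P A x y L) (h' : Joined P A y z L') : Joined P A x z (L + L') := by
  induction h with
  | refl x hL => exact h'.mono_length (by linarith)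
  | step h hx hy _ hL ih => exact .step h hx hy (ih h') (by linarith)

theorem symm (h : Joined P A x y L) : Joined P A y x L := by
  induction h with
  | refl x hL => exact .refl x hL
  | step h hx hy _ hL ih =>
    exact (ih.trans (single h.symm hy hx)).mono_length (by rw [dist_comm]; linarith)

/-- A path of length `L` starting at `x` stays within distance `L` of `x`. -/
theorem inter_closedBall (h : Joined P A x y L) :
    Joined P (A ∩ Metric.closedBall x L) x y L := by
  suffices H : ∀ c ρ, dist x c + L ≤ ρ → Joined P (A ∩ Metric.closedBall c ρ) x y L from
    H x L (by simp)
  induction h with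
  | refl x hL => exact fun _ _ _ => .refl x hL
  | @step x y z L L' h hx hy hyz hL ih =>
    intro c ρ hρ
    have h1 := hyz.nonneg
    have h2 : dist y c ≤ dist x y + dist x c := by
      rw [dist_comm x y]; exact dist_triangle _ _ _
    have h3 : 0 ≤ dist x y := dist_nonneg
    exact .step h ⟨hx, Metric.mem_closedBall.2 (by linarith)⟩
      ⟨hy, Metric.mem_closedBall.2 (by linarith)⟩ (ih c ρ (by linarith)) hL

/-- Paths are carried along distance-preserving maps; the hypotheses on the steps are only needed
within `A`. -/
theorem map {β : Type*} [PseudoMetricSpace β] {Q : Set (β × β)} {B : Set β} (φ : α → β)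
    (hφ : ∀ x y, dist (φ x) (φ y) = dist x y) (hB : ∀ x ∈ A, φ x ∈ B)
    (hQ : ∀ x ∈ A, ∀ y ∈ A, (x, y) ∈ P → (φ x, φ y) ∈ Q) (h : Joined P A x y L) :
    Joined Q B (φ x) (φ y) L := by
  induction h with
  | refl x hL => exact .refl _ hL
  | step h hx hy _ hL ih =>
    exact .step (h.imp (hQ _ hx _ hy) (hQ _ hy _ hx)) (hB _ hx) (hB _ hy) ih (by rwa [hφ])

end Joined

theorem Joined.exists_walk {V : Finset α} {P : Finset (α × α)} {S : Finset V} {x y : α} {L : ℝ}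
    (h : Joined (P : Set (α × α)) {z | ∃ hz : z ∈ V, (⟨z, hz⟩ : V) ∉ S} x y L)
    (hx : ∃ hz : x ∈ V, (⟨x, hz⟩ : V) ∉ S) (hy : ∃ hz : y ∈ V, (⟨y, hz⟩ : V) ∉ S) :
    ∃ w : ((graphOfPairs V P).induce (S : Set V)ᶜ).Walk ⟨⟨x, hx.1⟩, hx.2⟩ ⟨⟨y, hy.1⟩, hy.2⟩,
      walkLength w ≤ L := by
  induction h with
  | refl x hL => exact ⟨.nil, by simpa [walkLength] using hL⟩
  | @step x y z L L' h hx' hy' hyz hL ih =>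
    obtain ⟨w, hw⟩ := ih hy' hy
    by_cases hxy : x = y
    · subst hxy
      exact ⟨w, by linarith [dist_self x]⟩
    · have hadj : ((graphOfPairs V P).induce (S : Set V)ᶜ).Adj ⟨⟨x, hx.1⟩, hx.2⟩
          ⟨⟨y, hy'.1⟩, hy'.2⟩ := by
        rw [SimpleGraph.induce_adj, graphOfPairs, SimpleGraph.fromRel_adj]
        exact ⟨by simpa using hxy, h⟩
      refine ⟨.cons hadj w, ?_⟩
      have : walkLength (SimpleGraph.Walk.cons hadj w) = dist x y + walkLength w := by
        simp [walkLength, Subtype.dist_eq]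
      linarith

theorem joined_walkLength {V : Finset α} {G : SimpleGraph V} {P : Finset (α × α)} {S : Finset V}
    (hP : ∀ x y : V, G.Adj x y → ((x : α), (y : α)) ∈ P ∨ ((y : α), (x : α)) ∈ P)
    {x y : ((S : Set V)ᶜ : Set V)} (w : (G.induce (S : Set V)ᶜ).Walk x y) :
    Joined (P : Set (α × α)) {z | ∃ hz : z ∈ V, (⟨z, hz⟩ : V) ∉ S} x.1.1 y.1.1 (walkLength w) := by
  induction w with
  | nil => exact .refl _ (by simp [walkLength])
  | @cons x y z h w ih =>
    refine .step (hP _ _ h) ⟨x.1.2, x.2⟩ ⟨y.1.2, y.2⟩ ih (le_of_eq ?_)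
    simp [walkLength, Subtype.dist_eq]

/-- Hardiness of a graph on `V`, phrased with fault sets of ambient points and `Joined`. -/
theorem exists_pairs_of_isHardySpanner {V : Finset α} {G : SimpleGraph V} {f : ℕ → ℕ → ℝ} {t : ℝ}
    (hG : IsHardySpanner f t G) :
    ∃ P : Finset (α × α), P.card ≤ G.edgeSet.ncard ∧ ∀ T ⊆ V, ∃ T' : Finset α, T ⊆ T' ∧
      (T'.card : ℝ) ≤ f T.card V.card ∧ ∀ x ∈ V, x ∉ T' → ∀ y ∈ V, y ∉ T' →
        Joined (P : Set (α × α)) (V \ T : Set α) x y (t * dist x y) := by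
  classical
  obtain ⟨P, hPc, hP⟩ := exists_pairs V G
  refine ⟨P, hPc, fun T hT => ?_⟩
  obtain ⟨S', hS', hcard, hsp⟩ := hG (T.subtype (· ∈ V))
  refine ⟨S'.map (Function.Embedding.subtype _), fun x hx => ?_, ?_, ?_⟩
  · simp only [Finset.mem_map, Function.Embedding.coe_subtype]
    exact ⟨⟨x, hT hx⟩, hS' (by simpa using hx), rfl⟩
  · rw [Finset.card_map]
    have : (T.subtype (· ∈ V)).card = T.card := by
      rw [Finset.card_subtype, Finset.filter_true_of_mem hT]
    rwa [this, Fintype.card_coe] at hcard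
  · intro x hx hxT y hy hyT
    have hx' : (⟨x, hx⟩ : V) ∉ S' := fun h => hxT (by simpa [hx] using h)
    have hy' : (⟨y, hy⟩ : V) ∉ S' := fun h => hyT (by simpa [hy] using h)
    obtain ⟨w, hw⟩ := hsp ⟨⟨x, hx⟩, fun h => hx' (hS' h)⟩ hx' ⟨⟨y, hy⟩, fun h => hy' (hS' h)⟩ hy'
    refine ((joined_walkLength hP w).mono_length hw).mono le_rfl ?_
    rintro z ⟨hz, hzT⟩
    exact ⟨hz, fun h => hzT (by simpa using h)⟩

theorem isHardySpanner_graphOfPairs {V : Finset α} {P : Finset (α × α)} {f : ℕ → ℕ → ℝ} {t : ℝ}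
    (h : ∀ T ⊆ V, ∃ T' : Finset α, T ⊆ T' ∧ (T'.card : ℝ) ≤ f T.card V.card ∧
      ∀ x ∈ V, x ∉ T' → ∀ y ∈ V, y ∉ T' →
        Joined (P : Set (α × α)) (V \ T : Set α) x y (t * dist x y)) :
    IsHardySpanner f t (graphOfPairs V P) := by
  classical
  intro S
  obtain ⟨T', hT', hcard, hj⟩ := h (S.map (Function.Embedding.subtype _)) (fun x hx => by
    obtain ⟨y, _, rfl⟩ := Finset.mem_map.1 hx
    exact y.2)
  refine ⟨T'.subtype (· ∈ V), fun x hx => ?_, ?_, ?_⟩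
  · simp only [Finset.mem_subtype]
    exact hT' (Finset.mem_map_of_mem (Function.Embedding.subtype _) hx)
  · rw [Finset.card_map] at hcard
    rw [Fintype.card_coe]
    refine le_trans ?_ hcard
    rw [Finset.card_subtype]
    exact_mod_cast Finset.card_filter_le _ _
  · rintro ⟨⟨x, hx⟩, hxS⟩ hxT ⟨⟨y, hy⟩, hyS⟩ hyT
    have hxT' : x ∉ T' := fun h => hxT (by simpa using h)
    have hyT' : y ∉ T' := fun h => hyT (by simpa using h)
    refine ((hj x hx hxT' y hy hyT').mono (Q := P) (B := {z | ∃ hz : z ∈ V, (⟨z, hz⟩ : V) ∉ S})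
      le_rfl ?_).exists_walk ⟨hx, hxS⟩ ⟨hy, hyS⟩
    rintro z ⟨hz, hzS⟩
    exact ⟨hz, fun h => hzS (by simpa using ⟨hz, h⟩)⟩

end Joined

/-! ### Copies of a set of points -/

section Replicas

variable {d : ℕ}

theorem exists_dist_le_of_finset {α : Type*} [PseudoMetricSpace α] (R : Finset α) :
    ∃ B : ℝ, 0 ≤ B ∧ ∀ x ∈ R, ∀ y ∈ R, dist x y ≤ B :=
  ⟨Metric.diam (R : Set α), Metric.diam_nonneg, fun _ hx _ hy =>
    Metric.dist_le_diam_of_mem R.finite_toSet.isBounded hx hy⟩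

/-- Disjoint translates of a bounded set, as far from each other as desired. -/
theorem exists_far_translates (hd : 1 ≤ d) {B : ℝ} (hB : 0 ≤ B) (ρ : ℝ) :
    ∃ v : EuclideanSpace ℝ (Fin d), ∀ i j : ℕ, i ≠ j → ∀ x y : EuclideanSpace ℝ (Fin d),
      dist x y ≤ B → ρ < dist (x + (i : ℝ) • v) (y + (j : ℝ) • v) := by
  let v : EuclideanSpace ℝ (Fin d) := EuclideanSpace.single ⟨0, hd⟩ (|ρ| + B + 1)
  have hv : ‖v‖ = |ρ| + B + 1 := by
    simp only [v, PiLp.norm_single, Real.norm_eq_abs]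
    exact abs_of_nonneg (by positivity)
  refine ⟨v, fun i j hij x y hxy => ?_⟩
  have h1 : (1 : ℝ) ≤ |(i : ℝ) - j| := by
    have : (1 : ℤ) ≤ |(i : ℤ) - j| := Int.one_le_abs (sub_ne_zero.2 (by exact_mod_cast hij))
    exact_mod_cast this
  have h2 : ‖((i : ℝ) - j) • v‖ ≤ dist (x + (i : ℝ) • v) (y + (j : ℝ) • v) + dist x y := by
    rw [dist_eq_norm, dist_eq_norm]
    calc _ = ‖((x + (i : ℝ) • v) - (y + (j : ℝ) • v)) - (x - y)‖ := by congr 1; module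
      _ ≤ _ := norm_sub_le _ _
  rw [norm_smul, Real.norm_eq_abs, hv] at h2
  have h3 : |ρ| + B + 1 ≤ |(i : ℝ) - j| * (|ρ| + B + 1) :=
    le_mul_of_one_le_left (by positivity) h1
  linarith [le_abs_self ρ]

theorem infinite_euclideanSpace (hd : 1 ≤ d) : Infinite (EuclideanSpace ℝ (Fin d)) := by
  obtain ⟨v, hv⟩ := exists_far_translates hd le_rfl 0
  refine Infinite.of_injective (fun i : ℕ => (0 : EuclideanSpace ℝ (Fin d)) + (i : ℝ) • v)
    fun i j hij => ?_
  by_contra h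
  exact (hv i j h 0 0 (by simp)).ne' (dist_eq_zero.2 hij)

/-- A set `R` of at most `n` points has hardy spanners whose parameter `n` is prescribed and whose
fault bound is `f k n` for every `k` bounding the number of faults. Nothing is known about the
monotonicity of `f` and `s`, so the hypothesis is applied to exactly `n` points: about `n / |R|`
distant translates of `R`, of which one receives few edges, and with a fault set padded to exactly
`k` points. -/
theorem exists_pairs_of_card_le (hd : 1 ≤ d) {t₀ : ℝ} (ht₀ : 0 ≤ t₀) {f : ℕ → ℕ → ℝ} {s : ℕ → ℝ}
    (hs : ∀ n, 1 ≤ s n) (h : HardySpannersExist d t₀ f (fun n => n * s n)) :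
    ∃ C : ℝ, 0 < C ∧ ∀ (n : ℕ) (R : Finset (EuclideanSpace ℝ (Fin d))), R.card ≤ n →
      ∃ P : Finset (EuclideanSpace ℝ (Fin d) × EuclideanSpace ℝ (Fin d)),
        (P.card : ℝ) ≤ C * ((R.card - 1 : ℕ) * s n) ∧
        ∀ T ⊆ R, ∀ k, T.card ≤ k → k ≤ n → ∃ T' : Finset (EuclideanSpace ℝ (Fin d)), T ⊆ T' ∧
          (T'.card : ℝ) ≤ f k n ∧ ∀ x ∈ R, x ∉ T' → ∀ y ∈ R, y ∉ T' →
            Joined (P : Set _) (R \ T : Set _) x y (t₀ * dist x y) := by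
  classical
  obtain ⟨C, hC, hG⟩ := h
  refine ⟨4 * C, by positivity, fun n R hRn => ?_⟩
  rcases le_or_gt R.card 1 with hR1 | hR2
  · refine ⟨∅, by rw [Nat.sub_eq_zero_of_le hR1]; simp, fun T hT k hTk hkn => ⟨T, le_rfl, ?_, ?_⟩⟩
    · have := infinite_euclideanSpace hd
      obtain ⟨V, hV⟩ := Infinite.exists_subset_card_eq (EuclideanSpace ℝ (Fin d)) n
      obtain ⟨G, -, hH⟩ := hG V
      obtain ⟨P, -, hP⟩ := exists_pairs_of_isHardySpanner hH
      obtain ⟨S, hSV, hSk⟩ := Finset.exists_subset_card_eq (hkn.trans hV.ge)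
      obtain ⟨S', hSS', hS', -⟩ := hP S hSV
      rw [hSk, hV] at hS'
      refine le_trans ?_ hS'
      exact_mod_cast hTk.trans (hSk ▸ Finset.card_le_card hSS')
    · intro x hx _ y hy _
      rw [Finset.card_le_one.1 hR1 x hx y hy]
      exact .refl _ (by simp)
  obtain ⟨B, hB0, hB⟩ := exists_dist_le_of_finset R
  obtain ⟨v, hv⟩ := exists_far_translates hd hB0 (t₀ * B)
  let φ : ℕ → EuclideanSpace ℝ (Fin d) → EuclideanSpace ℝ (Fin d) := fun i p => p + (i : ℝ) • v
  have hφd : ∀ i x y, dist (φ i x) (φ i y) = dist x y := fun i x y => dist_add_right _ _ _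
  have hφi : ∀ i, Function.Injective (φ i) := fun i x y hxy => add_right_cancel hxy
  have hsep : ∀ i j, ∀ x ∈ R, ∀ y ∈ R, dist (φ i x) (φ j y) ≤ t₀ * B → i = j := by
    intro i j x hx y hy hxy
    by_contra hij
    exact (hv i j hij x y (hB x hx y hy)).not_ge hxy
  set r := R.card with hr
  set m := n / r with hm
  have hmr : m * r ≤ n := Nat.div_mul_le_self n r
  have hnm : n ≤ (m + 1) * r := by
    rw [add_mul, one_mul, mul_comm]
    have := Nat.lt_mul_div_succ n (show 0 < r by lia)
    rw [← hm, mul_add, mul_one] at this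
    exact this.le
  have hm1 : 1 ≤ m := (Nat.one_le_div_iff (by lia)).2 hRn
  obtain ⟨J, hJ1, hJ2, hJn⟩ := Finset.exists_subsuperset_card_eq (n := n)
    (s := Finset.range m ×ˢ R) (t := Finset.range (m + 1) ×ˢ R)
    (Finset.product_subset_product_left (Finset.range_subset_range.2 (by lia)))
    (by rwa [Finset.card_product, Finset.card_range])
    (by rwa [Finset.card_product, Finset.card_range])
  have hJR : ∀ p ∈ J, p.2 ∈ R := fun p hp => (Finset.mem_product.1 (hJ2 hp)).2
  set W := J.image (fun p => φ p.1 p.2) with hW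
  have hWn : W.card = n := by
    rw [hW, Finset.card_image_of_injOn, hJn]
    rintro ⟨i, x⟩ hx ⟨j, y⟩ hy (hxy : φ i x = φ j y)
    obtain rfl : i = j := hsep i j x (hJR _ hx) y (hJR _ hy) (by rw [hxy, dist_self]; positivity)
    rw [hφi i hxy]
  have hφW : ∀ i < m, ∀ x ∈ R, φ i x ∈ W := fun i hi x hx =>
    Finset.mem_image_of_mem (fun p : ℕ × EuclideanSpace ℝ (Fin d) => φ p.1 p.2) (a := (i, x))
      (hJ1 (Finset.mem_product.2 ⟨Finset.mem_range.2 hi, hx⟩))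
  obtain ⟨G, hGe, hH⟩ := hG W
  obtain ⟨Q, hQe, hQ⟩ := exists_pairs_of_isHardySpanner hH
  -- The pairs of `Q` inside the `i`-th translate of `R`, moved back to `R`.
  let P : ℕ → Finset (EuclideanSpace ℝ (Fin d) × EuclideanSpace ℝ (Fin d)) := fun i =>
    (R ×ˢ R).filter fun p => (φ i p.1, φ i p.2) ∈ Q
  have hsum : ∑ i ∈ Finset.range m, (P i).card ≤ Q.card := by
    rw [← Finset.card_sigma]
    refine Finset.card_le_card_of_injOn (fun a => (φ a.1 a.2.1, φ a.1 a.2.2)) ?_ ?_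
    · intro a ha
      exact (Finset.mem_filter.1 (Finset.mem_sigma.1 ha).2).2
    · rintro ⟨i, x, y⟩ ha ⟨j, x', y'⟩ hb hab
      simp only [Finset.coe_sigma, Set.mem_sigma_iff, Finset.mem_coe, P, Finset.mem_filter,
        Finset.mem_product, Prod.mk.injEq] at ha hb hab
      obtain rfl : i = j := hsep i j x ha.2.1.1 x' hb.2.1.1
        (by rw [hab.1, dist_self]; positivity)
      rw [hφi i hab.1, hφi i hab.2]
  obtain ⟨i, hi, hPi⟩ : ∃ i ∈ Finset.range m, ((P i).card : ℝ) ≤ Q.card / m := by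
    refine Finset.exists_le_of_sum_le (Finset.nonempty_range_iff.2 (by lia)) ?_
    rw [Finset.sum_const, Finset.card_range, nsmul_eq_mul, mul_div_cancel₀ _ (by positivity)]
    exact_mod_cast hsum
  rw [Finset.mem_range] at hi
  refine ⟨P i, ?_, fun T hT k hTk hkn => ?_⟩
  · have h1 : (Q.card : ℝ) ≤ C * (n * s n) := by
      rw [hWn] at hGe
      exact le_trans (by exact_mod_cast hQe) hGe
    have h2 : (n : ℝ) ≤ 4 * ((r - 1 : ℕ) : ℝ) * m := by
      have : n ≤ 4 * (r - 1) * m := by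
        obtain ⟨q, hq⟩ : ∃ q, r = q + 2 := ⟨r - 2, by lia⟩
        rw [hq] at hnm ⊢
        refine hnm.trans ?_
        rw [show q + 2 - 1 = q + 1 by lia]
        nlinarith
      exact_mod_cast this
    have hm0 : (0 : ℝ) < m := by exact_mod_cast hm1
    refine hPi.trans ((div_le_iff₀ hm0).2 (h1.trans ?_))
    have h3 : 0 ≤ s n := zero_le_one.trans (hs n)
    calc C * (n * s n) ≤ C * (4 * ((r - 1 : ℕ) : ℝ) * m * s n) := by gcongr
      _ = _ := by ring
  · have hTW : T.image (φ i) ⊆ W := fun z hz => by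
      obtain ⟨x, hx, rfl⟩ := Finset.mem_image.1 hz
      exact hφW i hi x (hT hx)
    obtain ⟨U, hTU, hUW, hUk⟩ := Finset.exists_subsuperset_card_eq hTW
      (Finset.card_image_le.trans hTk) (hkn.trans hWn.ge)
    obtain ⟨U', hUU', hU'c, hU'⟩ := hQ U hUW
    rw [hUk, hWn] at hU'c
    refine ⟨R.filter fun x => φ i x ∈ U', fun x hx => ?_, le_trans ?_ hU'c, ?_⟩
    · exact Finset.mem_filter.2 ⟨hT hx, hUU' (hTU (Finset.mem_image_of_mem _ hx))⟩
    · exact_mod_cast Finset.card_le_card_of_injOn (φ i)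
        (fun x hx => (Finset.mem_filter.1 hx).2) (hφi i).injOn
    · intro x hx hxU y hy hyU
      have hxU' : φ i x ∉ U' := fun h => hxU (Finset.mem_filter.2 ⟨hx, h⟩)
      have hyU' : φ i y ∉ U' := fun h => hyU (Finset.mem_filter.2 ⟨hy, h⟩)
      have hJ := (hU' _ (hφW i hi x hx) hxU' _ (hφW i hi y hy) hyU').inter_closedBall
      rw [hφd] at hJ
      -- A short path cannot leave the translate, so it can be moved back to `R`.
      have hback : ∀ z ∈ (W \ U : Set _) ∩ Metric.closedBall (φ i x) (t₀ * dist x y),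
          ∃ p ∈ R, p ∉ T ∧ z = φ i p := by
        rintro z ⟨⟨hzW, hzU⟩, hzb⟩
        obtain ⟨⟨j, p⟩, hp, rfl⟩ := Finset.mem_image.1 (Finset.mem_coe.1 hzW)
        obtain rfl : j = i := hsep j i p (hJR _ hp) x hx ((Metric.mem_closedBall.1 hzb).trans
          (mul_le_mul_of_nonneg_left (hB x hx y hy) ht₀))
        exact ⟨p, hJR _ hp, fun hpT => hzU (hTU (Finset.mem_image_of_mem _ hpT)), rfl⟩
      let ψ : EuclideanSpace ℝ (Fin d) → EuclideanSpace ℝ (Fin d) := fun z => z - (i : ℝ) • v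
      have hψ : ∀ p, ψ (φ i p) = p := fun p => add_sub_cancel_right _ _
      have := hJ.map (Q := (P i : Set _)) (B := (R \ T : Set _)) ψ
        (fun a b => dist_sub_right _ _ _)
        (fun z hz => by
          obtain ⟨p, hp, hpT, rfl⟩ := hback z hz
          rw [hψ]
          exact ⟨hp, hpT⟩)
        (fun z hz z' hz' hzz' => by
          obtain ⟨p, hp, -, rfl⟩ := hback z hz
          obtain ⟨p', hp', -, rfl⟩ := hback z' hz'
          rw [hψ, hψ]
          exact Finset.mem_filter.2 ⟨Finset.mk_mem_product hp hp', hzz'⟩)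
      rwa [hψ, hψ] at this

end Replicas

/-! ### Yao graphs -/

section Yao

variable {d : ℕ}

/-- Finitely many cones with apex `0`, of angular width `θ` in the chordal sense, cover the space.
On the line two half-lines do, with `θ = 0`. -/
theorem exists_cones {θ : ℝ} (hθ : 0 ≤ θ) (hd : d ≠ 1 → 0 < θ) :
    ∃ (K : ℕ) (κ : EuclideanSpace ℝ (Fin d) → Fin K), ∀ u v, u ≠ 0 → v ≠ 0 → κ u = κ v →
      ‖‖u‖⁻¹ • u - ‖v‖⁻¹ • v‖ ≤ θ := by
  classical
  by_cases h1 : d = 1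
  · subst h1
    refine ⟨2, fun u => if 0 < u 0 then 0 else 1, fun u v hu hv huv => ?_⟩
    have hn : ∀ w : EuclideanSpace ℝ (Fin 1), ‖w‖ = |w 0| := fun w => by
      simp [EuclideanSpace.norm_eq, Real.sqrt_sq_eq_abs]
    have h0 : ∀ w : EuclideanSpace ℝ (Fin 1), w ≠ 0 → w 0 ≠ 0 := fun w hw h => by
      exact hw (norm_eq_zero.1 (by rw [hn, h, abs_zero]))
    rw [hn (_ - _)]
    refine le_trans (le_of_eq ?_) hθ
    rw [abs_eq_zero]
    simp only [PiLp.sub_apply, PiLp.smul_apply, smul_eq_mul, hn]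
    rcases (h0 u hu).lt_or_gt with hu' | hu' <;> rcases (h0 v hv).lt_or_gt with hv' | hv'
    · rw [abs_of_neg hu', abs_of_neg hv', inv_neg, inv_neg, neg_mul, neg_mul,
        inv_mul_cancel₀ hu'.ne, inv_mul_cancel₀ hv'.ne, sub_self]
    · simp [hu'.not_gt, hv'] at huv
    · simp [hv'.not_gt, hu'] at huv
    · rw [abs_of_pos hu', abs_of_pos hv', inv_mul_cancel₀ hu'.ne', inv_mul_cancel₀ hv'.ne',
        sub_self]
  · have hθ' : 0 < θ / 2 := half_pos (hd h1)
    obtain ⟨F, -, hF, hcov⟩ := finite_cover_balls_of_compact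
      (isCompact_sphere (0 : EuclideanSpace ℝ (Fin d)) 1) hθ'
    have := hF.fintype
    have hex : ∀ u : EuclideanSpace ℝ (Fin d), ∃ c : Option F, u ≠ 0 →
        ∃ p ∈ c, dist (‖u‖⁻¹ • u) p.1 < θ / 2 := by
      intro u
      by_cases hu : u = 0
      · exact ⟨none, fun h => absurd hu h⟩
      · have hu1 : ‖u‖⁻¹ • u ∈ Metric.sphere (0 : EuclideanSpace ℝ (Fin d)) 1 := by
          rw [mem_sphere_zero_iff_norm, norm_smul, norm_inv, norm_norm,
            inv_mul_cancel₀ (norm_ne_zero_iff.2 hu)]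
        obtain ⟨c, hc, hb⟩ := Set.mem_iUnion₂.1 (hcov hu1)
        exact ⟨some ⟨c, hc⟩, fun _ => ⟨_, rfl, hb⟩⟩
    choose κ hκ using hex
    refine ⟨Fintype.card (Option F), fun u => Fintype.equivFin _ (κ u), fun u v hu hv huv => ?_⟩
    obtain ⟨p, hp, hup⟩ := hκ u hu
    obtain ⟨p', hp', hvp⟩ := hκ v hv
    rw [(Fintype.equivFin _).injective huv] at hp
    obtain rfl : p = p' := Option.mem_unique hp hp'
    rw [← dist_eq_norm]
    exact (dist_triangle_right _ _ _).trans ((add_lt_add hup hvp).le.trans_eq (add_halves θ))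

/-- **Yao graph.** Every finite set has a spanner with linearly many edges, of any stretch `t > 1`,
and on the line also of stretch `1`: every point is joined to a nearest point in each cone around
it, and following the cone of the target decreases the distance to it fast enough. -/
theorem exists_linear_spanner {t : ℝ} (ht : 1 ≤ t) (hd : d ≠ 1 → 1 < t) :
    ∃ K : ℕ, ∀ A : Finset (EuclideanSpace ℝ (Fin d)),
      ∃ P : Finset (EuclideanSpace ℝ (Fin d) × EuclideanSpace ℝ (Fin d)), P.card ≤ K * A.card ∧
        ∀ x ∈ A, ∀ y ∈ A, Joined (P : Set _) (A : Set _) x y (t * dist x y) := by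
  classical
  have ht0 : 0 < t := by linarith
  obtain ⟨K, κ, hκ⟩ := exists_cones (d := d) (θ := 1 - t⁻¹)
    (sub_nonneg.2 (inv_le_one_of_one_le₀ ht)) (fun h => sub_pos.2 (inv_lt_one_of_one_lt₀ (hd h)))
  refine ⟨K, fun A => ?_⟩
  have hnear : ∀ (x : EuclideanSpace ℝ (Fin d)) (c : Fin K), ∃ q, ∀ y ∈ A, y ≠ x → κ (y - x) = c →
      q ∈ A ∧ q ≠ x ∧ κ (q - x) = c ∧ dist x q ≤ dist x y := by
    intro x c
    rcases (A.filter fun y => y ≠ x ∧ κ (y - x) = c).eq_empty_or_nonempty with he | hne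
    · refine ⟨x, fun y hy hyx hyc => ?_⟩
      have : y ∈ A.filter fun y => y ≠ x ∧ κ (y - x) = c := Finset.mem_filter.2 ⟨hy, hyx, hyc⟩
      simp [he] at this
    · obtain ⟨q, hq, hmin⟩ := Finset.exists_min_image _ (dist x) hne
      obtain ⟨hqA, hqx, hqc⟩ := Finset.mem_filter.1 hq
      exact ⟨q, fun y hy hyx hyc => ⟨hqA, hqx, hqc, hmin y (Finset.mem_filter.2 ⟨hy, hyx, hyc⟩)⟩⟩
  choose q hq using hnear
  refine ⟨(Finset.univ ×ˢ A).image fun p => (p.2, q p.2 p.1), ?_, fun x hx y hy => ?_⟩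
  · refine Finset.card_image_le.trans ?_
    simp [Finset.card_product]
  · induction hN : (A.filter fun z => dist z y < dist x y).card using Nat.strong_induction_on
      generalizing x with
    | _ N ih =>
      subst hN
      rcases eq_or_ne y x with rfl | hyx
      · exact .refl _ (by simp)
      obtain ⟨hzA, hzx, hzc, hzd⟩ := hq x (κ (y - x)) y hy hyx rfl
      set z := q x (κ (y - x)) with hz
      have hang := hκ _ _ (sub_ne_zero.2 hzx) (sub_ne_zero.2 hyx) hzc
      have ha : dist x z = ‖z - x‖ := by rw [dist_comm, dist_eq_norm]
      have hb : dist x y = ‖y - x‖ := by rw [dist_comm, dist_eq_norm]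
      have hapos : 0 < ‖z - x‖ := norm_pos_iff.2 (sub_ne_zero.2 hzx)
      have hbpos : 0 < ‖y - x‖ := norm_pos_iff.2 (sub_ne_zero.2 hyx)
      -- With `a = |xz| ≤ b = |xy|` and unit directions `u`, `v`,
      -- `a u - b v = a (u - v) - (b - a) v`, of norm at most `a (1 - 1 / t) + (b - a)`.
      have hzy : dist z y ≤ dist x y - t⁻¹ * dist x z := by
        have hid : z - y = ‖z - x‖ • (‖z - x‖⁻¹ • (z - x) - ‖y - x‖⁻¹ • (y - x)) -
            (‖y - x‖ - ‖z - x‖) • (‖y - x‖⁻¹ • (y - x)) := by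
          rw [smul_sub, sub_smul, smul_inv_smul₀ hapos.ne', smul_inv_smul₀ hbpos.ne']
          abel
        have hunit : ‖‖y - x‖⁻¹ • (y - x)‖ = 1 := by
          rw [norm_smul, norm_inv, norm_norm, inv_mul_cancel₀ hbpos.ne']
        rw [ha, hb, dist_eq_norm, hid]
        rw [ha, hb] at hzd
        refine (norm_sub_le _ _).trans ?_
        rw [norm_smul, norm_smul, norm_norm, hunit, Real.norm_eq_abs,
          abs_of_nonneg (sub_nonneg.2 hzd)]
        have := mul_le_mul_of_nonneg_left hang hapos.le
        linarith
      have hlt : dist z y < dist x y := by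
        have : 0 < t⁻¹ * dist x z := mul_pos (inv_pos.2 ht0) (ha ▸ hapos)
        linarith
      refine .step (.inl ?_) hx hzA (ih _ ?_ z hzA rfl) ?_
      · exact Finset.mem_coe.2 (Finset.mem_image.2
          ⟨(κ (y - x), x), Finset.mk_mem_product (Finset.mem_univ _) hx, rfl⟩)
      · refine Finset.card_lt_card (Finset.ssubset_iff_of_subset (fun w hw => ?_) |>.2
          ⟨z, Finset.mem_filter.2 ⟨hzA, hlt⟩, fun h => (Finset.mem_filter.1 h).2.false⟩)
        obtain ⟨hwA, hw⟩ := Finset.mem_filter.1 hw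
        exact Finset.mem_filter.2 ⟨hwA, hw.trans hlt⟩
      · have := mul_le_mul_of_nonneg_left hzy ht0.le
        rw [mul_sub, ← mul_assoc, mul_inv_cancel₀ ht0.ne', one_mul] at this
        linarith

end Yao

/-! ### Locality-sensitive orders -/

section Orders

/-- In the order given by the keys `r`, the point `x` comes before `y`, and for any two points `z`
and `w` between them, in this order, one gets from `x` to `y` with stretch `t` by going straight to `z`,
then to `w` along a path of stretch `t₀`, then straight to `y`. -/
def Separates {α β : Type*} [PseudoMetricSpace α] [Preorder β] (t₀ t : ℝ) (V : Finset α)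
    (r : α → β) (x y : α) : Prop :=
  r x < r y ∧ ∀ z ∈ V, ∀ w ∈ V, r x ≤ r z → r z ≤ r w → r w ≤ r y →
    dist x z + t₀ * dist z w + dist w y ≤ t * dist x y

/-- A finite set can be enumerated in the order of given keys, ties being broken arbitrarily. -/
theorem exists_position {α β : Type*} [LinearOrder β] (V : Finset α) (key : α → β) :
    ∃ pos : α → ℕ, Set.BijOn pos V (Set.Iio V.card) ∧
      ∀ x ∈ V, ∀ y ∈ V, pos x ≤ pos y → key x ≤ key y := by
  classical
  let e := V.equivFin
  let σ := Tuple.sort fun j => key (e.symm j)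
  have hσ : Monotone ((fun j => key (e.symm j)) ∘ σ) := Tuple.monotone_sort _
  let pos : α → ℕ := fun x => if h : x ∈ V then σ.symm (e ⟨x, h⟩) else 0
  have hpos : ∀ x (h : x ∈ V), pos x = σ.symm (e ⟨x, h⟩) := fun x h => by simp [pos, h]
  refine ⟨pos, ⟨fun x hx => ?_, fun x hx y hy hxy => ?_, fun j hj => ?_⟩, fun x hx y hy hxy => ?_⟩
  · rw [hpos x hx]
    exact (σ.symm (e ⟨x, hx⟩)).2
  · rw [hpos x hx, hpos y hy] at hxy
    exact congrArg Subtype.val (e.injective (σ.symm.injective (Fin.ext hxy)))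
  · refine ⟨e.symm (σ ⟨j, hj⟩), (e.symm (σ ⟨j, hj⟩)).2, ?_⟩
    rw [hpos _ (e.symm (σ ⟨j, hj⟩)).2]
    simp
  · rw [hpos x hx, hpos y hy] at hxy
    simpa using hσ (Fin.le_def.2 hxy)

theorem Separates.of_monotone {α β γ : Type*} [PseudoMetricSpace α] [LinearOrder β] [LinearOrder γ]
    {t₀ t : ℝ} {V : Finset α} {r : α → β} {r' : α → γ}
    (h : ∀ x ∈ V, ∀ y ∈ V, r' x ≤ r' y → r x ≤ r y) {x y : α} (hx : x ∈ V) (hy : y ∈ V)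
    (hs : Separates t₀ t V r x y) : Separates t₀ t V r' x y :=
  ⟨not_le.1 fun hyx => (h y hy x hx hyx).not_gt hs.1, fun z hz w hw h1 h2 h3 =>
    hs.2 z hz w hw (h x hx z hz h1) (h z hz w hw h2) (h w hw y hy h3)⟩

theorem lex_apply_le {a b : ℕ → ℕ} (h : toLex a ≤ toLex b) {k : ℕ} (hk : ∀ j < k, a j = b j) :
    a k ≤ b k := by
  rcases h.eq_or_lt with h | ⟨i, hi, hlt⟩
  · rw [toLex.injective h]
  · rcases lt_trichotomy i k with hik | rfl | hik
    · exact absurd (hk i hik) (ne_of_lt hlt)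
    · exact le_of_lt hlt
    · exact (hi k hik).le

theorem lex_apply_eq {a b c : ℕ → ℕ} (hab : toLex a ≤ toLex b) (hbc : toLex b ≤ toLex c) {k : ℕ}
    (hk : ∀ j < k, a j = c j) (j : ℕ) (hj : j < k) : b j = a j := by
  induction j using Nat.strong_induction_on with
  | _ j ih =>
    refine le_antisymm ?_ (lex_apply_le hab fun i hi => (ih i hi (hi.trans hj)).symm)
    rw [hk j hj]
    exact lex_apply_le hbc fun i hi => (ih i hi (hi.trans hj)).trans (hk i (hi.trans hj))

variable {d : ℕ}

/-- The index of the cell of `a` in the grid of side `2 ^ (-M k)`. -/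
noncomputable def cell (M : ℕ) (a : Fin d → ℝ) (k : ℕ) (c : Fin d) : ℤ := ⌊a c * 2 ^ (M * k)⌋

/-- The position of the cell of `a` at level `k` among the `2 ^ (M d)` children of its parent. -/
noncomputable def digits (M : ℕ) (a : Fin d → ℝ) (k : ℕ) (c : Fin d) : ZMod (2 ^ M) :=
  (cell M a k c : ZMod (2 ^ M))

open Classical in
/-- A numbering of a finite type that starts with `i` and `i'`, in this order. -/
noncomputable def startingWith {ι : Type*} [Fintype ι] (i i' δ : ι) : ℕ :=
  if δ = i then 0 else if δ = i' then 1 else Fintype.equivFin ι δ + 2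

theorem startingWith_injective {ι : Type*} [Fintype ι] (i i' : ι) :
    Function.Injective (startingWith i i') := by
  intro δ δ' h
  unfold startingWith at h
  split_ifs at h <;> try lia
  · exact (Fintype.equivFin ι).injective (Fin.ext (by lia))

/-- The address of `a` in the quadtree, compared lexicographically: first the top cell, then at
every level the child that contains `a`, the children numbered starting with `i` and `i'`. -/
noncomputable def gridKey (M : ℕ) (i i' : Fin d → ZMod (2 ^ M)) (a : Fin d → ℝ) : ℕ → ℕ
  | 0 => Encodable.encode (cell M a 0)
  | k + 1 => startingWith i i' (digits M a (k + 1))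

theorem floor_mul_eq_of_cast_eq {N : ℕ} (hN : 0 < N) {u v : ℝ} (h : ⌊u⌋ = ⌊v⌋)
    (hmod : ((⌊u * N⌋ : ℤ) : ZMod N) = (⌊v * N⌋ : ℤ)) : ⌊u * N⌋ = ⌊v * N⌋ := by
  have hN' : (0 : ℝ) < N := by exact_mod_cast hN
  have key : ∀ u : ℝ, ⌊u⌋ * N ≤ ⌊u * N⌋ ∧ ⌊u * N⌋ < ⌊u⌋ * N + N := fun u => by
    constructor
    · rw [Int.le_floor]
      push_cast
      exact mul_le_mul_of_nonneg_right (Int.floor_le u) hN'.le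
    · rw [Int.floor_lt]
      push_cast
      nlinarith [Int.lt_floor_add_one u]
  have hdvd := (ZMod.intCast_eq_intCast_iff_dvd_sub _ _ _).1 hmod
  have h1 := key u
  have h2 := key v
  rw [h] at h1
  have := Int.eq_zero_of_abs_lt_dvd hdvd (abs_lt.2 ⟨by linarith, by linarith⟩)
  linarith

theorem floor_eq_of_floor_mul_eq {N : ℕ} (hN : 0 < N) {u v : ℝ} (h : ⌊u * N⌋ = ⌊v * N⌋) :
    ⌊u⌋ = ⌊v⌋ := by
  have hN' : (N : ℝ) ≠ 0 := by exact_mod_cast hN.ne'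
  rw [← mul_div_cancel_right₀ u hN', ← mul_div_cancel_right₀ v hN', Int.floor_div_natCast,
    Int.floor_div_natCast, h]

theorem cell_succ (M : ℕ) (a : Fin d → ℝ) (k : ℕ) (c : Fin d) :
    cell M a (k + 1) c = ⌊a c * 2 ^ (M * k) * ((2 ^ M : ℕ) : ℝ)⌋ := by
  rw [cell]
  congr 1
  push_cast
  ring

theorem cell_succ_eq {M : ℕ} {a b : Fin d → ℝ} {k : ℕ} (h : cell M a k = cell M b k)
    (hd : digits M a (k + 1) = digits M b (k + 1)) : cell M a (k + 1) = cell M b (k + 1) := by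
  funext c
  have h1 := congrFun h c
  have h2 := congrFun hd c
  rw [digits, digits] at h2
  rw [cell_succ, cell_succ] at h2 ⊢
  exact floor_mul_eq_of_cast_eq (by positivity) h1 h2

theorem cell_eq_of_cell_succ_eq {M : ℕ} {a b : Fin d → ℝ} {k : ℕ}
    (h : cell M a (k + 1) = cell M b (k + 1)) : cell M a k = cell M b k := by
  funext c
  have := congrFun h c
  rw [cell_succ, cell_succ] at this
  exact floor_eq_of_floor_mul_eq (by positivity) this

theorem gridKey_eq_of_cell_eq {M : ℕ} {i i' : Fin d → ZMod (2 ^ M)} {a b : Fin d → ℝ} {k : ℕ}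
    (h : cell M a k = cell M b k) : ∀ j < k + 1, gridKey M i i' a j = gridKey M i i' b j := by
  induction k with
  | zero =>
    intro j hj
    obtain rfl : j = 0 := by lia
    simp only [gridKey, h]
  | succ k ih =>
    intro j hj
    rcases (Nat.lt_succ_iff.1 hj).lt_or_eq with hj | rfl
    · exact ih (cell_eq_of_cell_succ_eq h) j hj
    · have : digits M a (k + 1) = digits M b (k + 1) := by
        unfold digits
        rw [h]
      simp only [gridKey, this]

theorem cell_eq_of_gridKey_eq {M : ℕ} {i i' : Fin d → ZMod (2 ^ M)} {a b : Fin d → ℝ} {k : ℕ}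
    (h : ∀ j < k + 1, gridKey M i i' a j = gridKey M i i' b j) : cell M a k = cell M b k := by
  induction k with
  | zero => exact Encodable.encode_injective (h 0 (by lia))
  | succ k ih =>
    exact cell_succ_eq (ih fun j hj => h j (by lia))
      (startingWith_injective _ _ (h (k + 1) (by lia)))

/-- Let `a` and `b` lie in the same cell at level `k` and in different children of it, and let the
numbering of children start with these two. Then only points of these two children lie between
`a` and `b`, those of the child of `a` first. -/
theorem gridKey_between {M : ℕ} {a b : Fin d → ℝ} {k : ℕ} (h : cell M a k = cell M b k)
    (hne : cell M a (k + 1) ≠ cell M b (k + 1)) {K : (Fin d → ℝ) → ℕ → ℕ}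
    (hK : K = gridKey M (digits M a (k + 1)) (digits M b (k + 1))) :
    toLex (K a) < toLex (K b) ∧ ∀ p q, toLex (K a) ≤ toLex (K p) → toLex (K p) ≤ toLex (K q) →
      toLex (K q) ≤ toLex (K b) →
      (cell M p (k + 1) = cell M a (k + 1) ∧ cell M q (k + 1) = cell M a (k + 1)) ∨
      (cell M p (k + 1) = cell M a (k + 1) ∧ cell M q (k + 1) = cell M b (k + 1)) ∨
      (cell M p (k + 1) = cell M b (k + 1) ∧ cell M q (k + 1) = cell M b (k + 1)) := by
  subst hK
  set i := digits M a (k + 1) with hi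
  set i' := digits M b (k + 1) with hi'
  have hii : i' ≠ i := fun e => hne (cell_succ_eq h e.symm)
  have hag := gridKey_eq_of_cell_eq (i := i) (i' := i') h
  have ha0 : gridKey M i i' a (k + 1) = 0 := by simp [gridKey, startingWith, ← hi]
  have hb1 : gridKey M i i' b (k + 1) = 1 := by simp [gridKey, startingWith, ← hi', hii]
  have hcell : ∀ p, toLex (gridKey M i i' a) ≤ toLex (gridKey M i i' p) →
      toLex (gridKey M i i' p) ≤ toLex (gridKey M i i' b) →
      (∀ j < k + 1, gridKey M i i' p j = gridKey M i i' a j) ∧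
      ((gridKey M i i' p (k + 1) = 0 ∧ cell M p (k + 1) = cell M a (k + 1)) ∨
       (gridKey M i i' p (k + 1) = 1 ∧ cell M p (k + 1) = cell M b (k + 1))) := by
    intro p h1 h2
    have hpa := lex_apply_eq h1 h2 hag
    refine ⟨hpa, ?_⟩
    have hle : gridKey M i i' p (k + 1) ≤ 1 :=
      (lex_apply_le h2 fun j hj => (hpa j hj).trans (hag j hj)).trans hb1.le
    have hca : cell M p k = cell M a k := cell_eq_of_gridKey_eq hpa
    rcases Nat.le_one_iff_eq_zero_or_eq_one.1 hle with h0 | h1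
    · exact .inl ⟨h0, cell_succ_eq hca (startingWith_injective i i' (h0.trans ha0.symm))⟩
    · exact .inr ⟨h1, cell_succ_eq (hca.trans h) (startingWith_injective i i' (h1.trans hb1.symm))⟩
  refine ⟨⟨k + 1, hag, ?_⟩, fun p q hap hpq hqb => ?_⟩
  · change gridKey M i i' a (k + 1) < gridKey M i i' b (k + 1)
    rw [ha0, hb1]
    exact one_pos
  · obtain ⟨hp, hp'⟩ := hcell p hap (hpq.trans hqb)
    obtain ⟨hq, hq'⟩ := hcell q (hap.trans hpq) hqb
    have hle : gridKey M i i' p (k + 1) ≤ gridKey M i i' q (k + 1) :=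
      lex_apply_le hpq fun j hj => (hp j hj).trans (hq j hj).symm
    rcases hp' with ⟨hp0, hpc⟩ | ⟨hp0, hpc⟩ <;> rcases hq' with ⟨hq0, hqc⟩ | ⟨hq0, hqc⟩
    · exact .inl ⟨hpc, hqc⟩
    · exact .inr (.inl ⟨hpc, hqc⟩)
    · lia
    · exact .inr (.inr ⟨hpc, hqc⟩)

/-- Two numbers closer than a third of the side of a dyadic grid lie in the same cell of the grid
or of the grid shifted by a third of its coarsest side: since `3` does not divide `2 ^ p`, the two
grids have no two boundary points closer than that. -/
theorem exists_floor_shift_eq {a b : ℝ} {p : ℕ} (h : |a - b| * 2 ^ p ≤ 1 / 3) :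
    ∃ τ : Bool,
      ⌊(a + if τ then 1 / 3 else 0) * 2 ^ p⌋ = ⌊(b + if τ then 1 / 3 else 0) * 2 ^ p⌋ := by
  wlog hab : a ≤ b generalizing a b
  · obtain ⟨τ, hτ⟩ := this (abs_sub_comm a b ▸ h) (le_of_not_ge hab)
    exact ⟨τ, hτ.symm⟩
  by_contra! hne
  have h2 : (0 : ℝ) < 2 ^ p := by positivity
  have key : ∀ s : ℝ, ⌊(a + s) * 2 ^ p⌋ ≠ ⌊(b + s) * 2 ^ p⌋ →
      (a + s) * 2 ^ p < ⌊(b + s) * 2 ^ p⌋ ∧ (⌊(b + s) * 2 ^ p⌋ : ℝ) ≤ (b + s) * 2 ^ p := fun s hs =>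
    ⟨Int.floor_lt.1 (lt_of_le_of_ne (Int.floor_mono (by gcongr)) hs), Int.floor_le _⟩
  obtain ⟨h3, h4⟩ := key _ (hne true)
  obtain ⟨h5, h6⟩ := key _ (hne false)
  simp only [if_true, Bool.false_eq_true, if_false, add_zero] at h3 h4 h5 h6
  set m := ⌊(b + 1 / 3) * 2 ^ p⌋
  set m' := ⌊b * 2 ^ p⌋
  rw [abs_of_nonpos (by linarith)] at h
  have h7 : (((3 * (m - m') - 2 ^ p : ℤ)) : ℝ) < 1 := by push_cast; linarith
  have h8 : (-1 : ℝ) < ((3 * (m - m') - 2 ^ p : ℤ) : ℝ) := by push_cast; linarith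
  have h9 : 3 * (m - m') - 2 ^ p < 1 := by exact_mod_cast h7
  have h10 : -1 < 3 * (m - m') - 2 ^ p := by exact_mod_cast h8
  have h11 : (3 : ℤ) ∣ 2 ^ p := ⟨m - m', by lia⟩
  have h12 := Int.prime_three.dvd_of_dvd_pow h11
  norm_num at h12

theorem dist_le_of_coord {x y : EuclideanSpace ℝ (Fin d)} {η : ℝ} (hη : 0 ≤ η)
    (h : ∀ c, |x c - y c| ≤ η) : dist x y ≤ √d * η := by
  rw [EuclideanSpace.dist_eq]
  refine Real.sqrt_le_iff.2 ⟨by positivity, ?_⟩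
  rw [mul_pow, Real.sq_sqrt (by positivity)]
  calc ∑ c, dist (x c) (y c) ^ 2 ≤ ∑ _c : Fin d, η ^ 2 :=
        Finset.sum_le_sum fun c _ => by
          rw [Real.dist_eq]
          exact pow_le_pow_left₀ (abs_nonneg _) (h c) 2
    _ = _ := by simp

theorem abs_coord_sub_le_dist (x y : EuclideanSpace ℝ (Fin d)) (c : Fin d) :
    |x c - y c| ≤ dist x y := by
  rw [dist_eq_norm]
  simpa using PiLp.norm_apply_le (x - y) c

/-- The point `x`, scaled by `μ` and shifted by `1 / 3` in the coordinates selected by `τ`. -/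
noncomputable def shifted (μ : ℝ) (τ : Fin d → Bool) (x : EuclideanSpace ℝ (Fin d)) (c : Fin d) :
    ℝ :=
  μ * x c + if τ c then 1 / 3 else 0

theorem dist_le_of_cell_eq {M : ℕ} {μ : ℝ} (hμ : 0 < μ) {τ : Fin d → Bool} {k : ℕ}
    {x y : EuclideanSpace ℝ (Fin d)}
    (h : cell M (shifted μ τ x) k = cell M (shifted μ τ y) k) :
    dist x y ≤ √d * (μ * 2 ^ (M * k))⁻¹ := by
  refine dist_le_of_coord (by positivity) fun c => ?_
  have h1 := Int.abs_sub_lt_one_of_floor_eq_floor (congrFun h c)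
  have h2 : shifted μ τ x c * 2 ^ (M * k) - shifted μ τ y c * 2 ^ (M * k) =
      (x c - y c) * (μ * 2 ^ (M * k)) := by
    rw [shifted, shifted]; ring
  have h3 : 0 < μ * 2 ^ (M * k) := by positivity
  rw [h2, abs_mul, abs_of_pos h3] at h1
  rw [← one_div, le_div_iff₀ h3]
  exact h1.le

/-- **Locality-sensitive orders.** A bounded number of quadtree orders is such that for any two
points `x` and `y` of `V`, the points between them in one of the orders consist of points near `x`
followed by points near `y`. The scales `2 ^ j` of the quadtrees, of branching `2 ^ M` per
coordinate, provide cells proportional to any distance, their shifts provide such cells that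
contain both points, and the numberings of the children make those of `x` and `y` neighbours. -/
theorem exists_gridKeys (d : ℕ) {ε : ℝ} (hε : 0 < ε) (hε1 : ε < 1) :
    ∃ (ι : Type) (_ : Fintype ι), ∀ V : Finset (EuclideanSpace ℝ (Fin d)),
      ∃ key : ι → EuclideanSpace ℝ (Fin d) → Lex (ℕ → ℕ), ∀ x ∈ V, ∀ y ∈ V, x ≠ y →
        ∃ i, key i x < key i y ∧ ∀ z w, key i x ≤ key i z → key i z ≤ key i w → key i w ≤ key i y →
          (dist x z ≤ ε * dist x y ∧ dist x w ≤ ε * dist x y) ∨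
          (dist x z ≤ ε * dist x y ∧ dist w y ≤ ε * dist x y) ∨
          (dist z y ≤ ε * dist x y ∧ dist w y ≤ ε * dist x y) := by
  -- A level is chosen with cells of side less than `6 D`, where `D = dist x y`; their children
  -- then have diameter at most `6 √d D / 2 ^ M ≤ ε D`.
  obtain ⟨M, hM⟩ := pow_unbounded_of_one_lt (6 * √d / ε + 1) (one_lt_two : (1 : ℝ) < 2)
  have hM0 : 0 < M := by
    rcases Nat.eq_zero_or_pos M with rfl | h
    · have : 0 ≤ 6 * √d / ε := by positivity
      simp only [pow_zero] at hM
      linarith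
    · exact h
  refine ⟨Fin M × (Fin d → Bool) × (Fin d → ZMod (2 ^ M)) × (Fin d → ZMod (2 ^ M)), inferInstance,
    fun V => ?_⟩
  obtain ⟨B, hB0, hB⟩ : ∃ B : ℝ, 0 ≤ B ∧ ∀ x ∈ V, ∀ y ∈ V, dist x y ≤ B :=
    exists_dist_le_of_finset V
  -- The unit of length: at scale `μ` all points of `V` are within distance `1 / 3` of each other.
  set μ : ℝ := (3 * (B + 1))⁻¹ with hμ
  have hμ0 : 0 < μ := by positivity
  refine ⟨fun i x => toLex (gridKey M i.2.2.1 i.2.2.2 (shifted (μ * 2 ^ (i.1 : ℕ)) i.2.1 x)),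
    fun x hx y hy hxy => ?_⟩
  set D := dist x y with hD
  have hD0 : 0 < D := dist_pos.2 hxy
  have h1 : 1 ≤ (3 * (μ * D))⁻¹ := by
    rw [one_le_inv₀ (by positivity), hμ]
    have : D ≤ B := hB x hx y hy
    rw [inv_mul_eq_div, ← mul_div_assoc, div_le_one (by positivity)]
    linarith
  obtain ⟨q, hq1, hq2⟩ := exists_nat_pow_near h1 (one_lt_two : (1 : ℝ) < 2)
  have hq1' : D * (μ * 2 ^ q) ≤ 1 / 3 := by
    rw [← one_div, le_div_iff₀ (by positivity)] at hq1
    linarith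
  have hq2' : 1 / 6 < D * (μ * 2 ^ q) := by
    rw [← one_div, div_lt_iff₀ (by positivity), pow_succ] at hq2
    linarith
  set k := q / M with hk
  have hqk : M * k + q % M = q := Nat.div_add_mod q M
  set ν : ℝ := μ * 2 ^ (q % M) with hν
  have hν0 : 0 < ν := by positivity
  have hνk : ν * 2 ^ (M * k) = μ * 2 ^ q := by
    rw [hν, mul_assoc, ← pow_add, add_comm, hqk]
  have hτ : ∀ c : Fin d, ∃ τ : Bool, ⌊(ν * x c + if τ then 1 / 3 else 0) * 2 ^ (M * k)⌋ =
      ⌊(ν * y c + if τ then 1 / 3 else 0) * 2 ^ (M * k)⌋ := by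
    intro c
    refine exists_floor_shift_eq ?_
    rw [← mul_sub, abs_mul, abs_of_pos hν0, mul_comm ν, mul_assoc, hνk]
    exact (mul_le_mul_of_nonneg_right (abs_coord_sub_le_dist x y c) (by positivity)).trans hq1'
  choose τ hτ using hτ
  have hsame : cell M (shifted ν τ x) k = cell M (shifted ν τ y) k := funext hτ
  have hnear : ∀ z w, cell M (shifted ν τ z) (k + 1) = cell M (shifted ν τ w) (k + 1) →
      dist z w ≤ ε * D := by
    intro z w hzw
    refine (dist_le_of_cell_eq hν0 hzw).trans ?_
    rw [mul_add, mul_one, pow_add, ← mul_assoc, hνk, ← div_eq_mul_inv, div_le_iff₀ (by positivity)]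
    have h3 : 6 * √d ≤ ε * 2 ^ M := by
      have : 6 * √d / ε ≤ 2 ^ M := by linarith
      rw [div_le_iff₀ hε] at this
      linarith
    have h4 : 0 ≤ ε * 2 ^ M := by positivity
    calc √d ≤ (ε * 2 ^ M) * (1 / 6) := by linarith
      _ ≤ (ε * 2 ^ M) * (D * (μ * 2 ^ q)) := mul_le_mul_of_nonneg_left hq2'.le h4
      _ = _ := by ring
  have hdiff : cell M (shifted ν τ x) (k + 1) ≠ cell M (shifted ν τ y) (k + 1) := fun h => by
    have := hnear x y h
    rw [← hD] at this
    nlinarith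
  obtain ⟨hlt, hbet⟩ := gridKey_between hsame hdiff rfl
  refine ⟨⟨⟨q % M, Nat.mod_lt _ hM0⟩, τ, _, _⟩, hlt, fun z w hxz hzw hwy => ?_⟩
  rcases hbet _ _ hxz hzw hwy with ⟨hz, hw⟩ | ⟨hz, hw⟩ | ⟨hz, hw⟩
  · exact .inl ⟨hnear _ _ hz.symm, hnear _ _ hw.symm⟩
  · exact .inr (.inl ⟨hnear _ _ hz.symm, hnear _ _ hw⟩)
  · exact .inr (.inr ⟨hnear _ _ hz, hnear _ _ hw⟩)

/-- A bounded number of enumerations of `V` separates all pairs of points. On the line the natural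
order does it, also for `t = t₀`. -/
theorem exists_orders {t₀ t : ℝ} (ht₀ : 1 ≤ t₀) (ht : t₀ ≤ t) (hlt : d ≠ 1 → t₀ < t) :
    ∃ (ι : Type) (_ : Fintype ι), ∀ V : Finset (EuclideanSpace ℝ (Fin d)),
      ∃ pos : ι → EuclideanSpace ℝ (Fin d) → ℕ, (∀ i, Set.BijOn (pos i) V (Set.Iio V.card)) ∧
        ∀ x ∈ V, ∀ y ∈ V, x ≠ y →
          ∃ i, Separates t₀ t V (pos i) x y ∨ Separates t₀ t V (pos i) y x := by
  by_cases hd : d = 1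
  · subst hd
    refine ⟨Unit, inferInstance, fun V => ?_⟩
    obtain ⟨pos, hpos, hmono⟩ := exists_position V fun x : EuclideanSpace ℝ (Fin 1) => x 0
    refine ⟨fun _ => pos, fun _ => hpos, fun x hx y hy hxy => ⟨(), ?_⟩⟩
    have hdist : ∀ x y : EuclideanSpace ℝ (Fin 1), dist x y = |x 0 - y 0| := fun x y => by
      simp [EuclideanSpace.dist_eq, Real.dist_eq, Real.sqrt_sq_eq_abs]
    have hsep : ∀ x y : EuclideanSpace ℝ (Fin 1), x 0 < y 0 →
        Separates t₀ t V (fun x => x 0) x y := by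
      intro x y hxy
      refine ⟨hxy, fun z _ w _ hxz hzw hwy => ?_⟩
      rw [hdist, hdist, hdist, hdist, abs_of_nonpos (by linarith), abs_of_nonpos (by linarith),
        abs_of_nonpos (by linarith), abs_of_nonpos (by linarith)]
      nlinarith
    have hne : x 0 ≠ y 0 := fun h => hxy (dist_eq_zero.1 (by rw [hdist, h, sub_self, abs_zero]))
    exact hne.lt_or_gt.imp (fun h => (hsep x y h).of_monotone hmono hx hy)
      (fun h => (hsep y x h).of_monotone hmono hy hx)
  · have hlt := hlt hd
    -- Along the detour, at most `4 t₀ ε` of stretch is added.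
    set ε := min ((t - t₀) / (4 * t₀)) (1 / 2) with hεdef
    have hε : 0 < ε := lt_min (div_pos (by linarith) (by linarith)) (by norm_num)
    have hε' : 4 * t₀ * ε ≤ t - t₀ := by
      rw [mul_comm, ← le_div_iff₀ (by linarith)]
      exact min_le_left _ _
    obtain ⟨ι, hι, hkey⟩ := exists_gridKeys d hε ((min_le_right _ _).trans_lt (by norm_num))
    refine ⟨ι, hι, fun V => ?_⟩
    obtain ⟨key, hkey⟩ := hkey V
    choose pos hpos hmono using fun i => exists_position V (key i)
    refine ⟨pos, hpos, fun x hx y hy hxy => ?_⟩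
    obtain ⟨i, hi, hbet⟩ := hkey x hx y hy hxy
    refine ⟨i, .inl (Separates.of_monotone (hmono i) hx hy ⟨hi, fun z _ w _ h1 h2 h3 => ?_⟩)⟩
    have hD : 0 ≤ dist x y := dist_nonneg
    have hεD : 0 ≤ ε * dist x y := by positivity
    have h4 : 4 * t₀ * (ε * dist x y) ≤ (t - t₀) * dist x y := by
      rw [← mul_assoc]
      exact mul_le_mul_of_nonneg_right hε' hD
    have h5 : ε * dist x y ≤ t₀ * (ε * dist x y) := le_mul_of_one_le_left hεD ht₀
    have h6 : dist x y ≤ t₀ * dist x y := le_mul_of_one_le_left hD ht₀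
    rcases hbet z w h1 h2 h3 with ⟨hz, hw⟩ | ⟨hz, hw⟩ | ⟨hz, hw⟩
    · have h7 : dist z w ≤ 2 * (ε * dist x y) := (dist_triangle_left z w x).trans (by linarith)
      have h8 : dist w y ≤ dist x w + dist x y := dist_triangle_left w y x
      nlinarith [mul_le_mul_of_nonneg_left h7 (zero_le_one.trans ht₀)]
    · have h7 : dist z w ≤ 2 * (ε * dist x y) + dist x y := by
        have := dist_triangle4 z x y w
        rw [dist_comm z x, dist_comm y w] at this
        linarith
      nlinarith [mul_le_mul_of_nonneg_left h7 (zero_le_one.trans ht₀)]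
    · have h7 : dist z w ≤ 2 * (ε * dist x y) := (dist_triangle_right z w y).trans (by linarith)
      have h8 : dist x z ≤ dist x y + dist z y := dist_triangle_right x z y
      nlinarith [mul_le_mul_of_nonneg_left h7 (zero_le_one.trans ht₀)]

end Orders

/-! ### Groups of consecutive points -/

section Groups

variable {α : Type*}

theorem sum_card_fiber_le (V : Finset α) (h : α → ℕ) {u : ℕ → ℕ} (hu : Function.Injective u)
    (I : Finset ℕ) : ∑ q ∈ I, (V.filter fun x => h x = u q).card ≤ V.card := by
  classical
  rw [← Finset.card_biUnion]
  · exact Finset.card_le_card (Finset.biUnion_subset.2 fun q _ => Finset.filter_subset _ _)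
  · intro q _ q' _ hqq'
    refine Finset.disjoint_left.2 fun x hx hx' => hqq' (hu ?_)
    rw [← (Finset.mem_filter.1 hx).2, (Finset.mem_filter.1 hx').2]

/-- **The part of the construction that belongs to one order.** The points are cut into groups of
`g` consecutive ones. Pairs of consecutive groups get a linear-size spanner, the first points of
the groups (the representatives) get a hardy spanner, and every point is joined to the
representatives of its own and of the next group. A group counts as faulty if it contains a fault,
and a point is given up if the representative of its own or of the next group is lost when the
representatives of the faulty groups fail. Of the other points, two that the order separates are
joined either inside two consecutive groups, which are free of faults, or through the
representatives of the group after the first and of the group of the second. -/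
theorem exists_pairs_of_position [PseudoMetricSpace α] {V : Finset α} {pos : α → ℕ}
    (hpos : Set.BijOn pos V (Set.Iio V.card)) {g K : ℕ} (hg : 0 < g) {t₀ t C σ : ℝ} (hC : 0 ≤ C)
    (hσ : σ ≤ g) {F : ℕ → ℝ}
    (hlocal : ∀ A : Finset α, ∃ P : Finset (α × α), P.card ≤ K * A.card ∧
      ∀ x ∈ A, ∀ y ∈ A, Joined (P : Set _) (A : Set _) x y (t * dist x y))
    (hrep : ∀ R ⊆ V, ∃ P : Finset (α × α), (P.card : ℝ) ≤ C * ((R.card - 1 : ℕ) * σ) ∧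
      ∀ T ⊆ R, ∀ k, T.card ≤ k → k ≤ V.card → ∃ T' : Finset α, T ⊆ T' ∧ (T'.card : ℝ) ≤ F k ∧
        ∀ x ∈ R, x ∉ T' → ∀ y ∈ R, y ∉ T' →
          Joined (P : Set _) (R \ T : Set _) x y (t₀ * dist x y)) :
    ∃ P : Finset (α × α), (P.card : ℝ) ≤ (2 * K + 2 + C) * V.card ∧
      ∀ T ⊆ V, ∃ T' : Finset α, (T'.card : ℝ) ≤ 2 * g * F T.card ∧
        ∀ x ∈ V, x ∉ T' → ∀ y ∈ V, y ∉ T' → Separates t₀ t V pos x y →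
          Joined (P : Set _) (V \ T : Set _) x y (t * dist x y) := by
  classical
  rcases V.eq_empty_or_nonempty with rfl | ⟨x₀, -⟩
  · refine ⟨∅, by simp, fun T hT => ⟨∅, ?_, by simp⟩⟩
    obtain ⟨_, -, h⟩ := hrep ∅ le_rfl
    obtain ⟨T', -, hT', -⟩ := h ∅ le_rfl T.card (by simp) (Finset.card_le_card hT)
    have : 0 ≤ F T.card := le_trans (by positivity) hT'
    simp only [Finset.card_empty, Nat.cast_zero]
    positivity
  set n := V.card with hn
  have hposn : ∀ x ∈ V, pos x < n := fun x hx => hpos.mapsTo hx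
  -- The point `pt j` at position `j`; beyond the last position its value is irrelevant.
  have hinv : ∀ j, ∃ x, j < n → x ∈ V ∧ pos x = j := fun j => by
    by_cases hj : j < n
    · obtain ⟨x, hx, hxj⟩ := hpos.surjOn hj
      exact ⟨x, fun _ => ⟨hx, hxj⟩⟩
    · exact ⟨x₀, fun h => absurd h hj⟩
  choose pt hpt using hinv
  have hdiv : ∀ j, j / g * g ≤ j := fun j => Nat.div_mul_le_self j g
  let block : ℕ → Finset α := fun q => V.filter fun x => pos x / g = q ∨ pos x / g = q + 1
  choose local' hlocal_card hlocal_joined using fun q => hlocal (block q)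
  set R : Finset α := V.filter fun x => g ∣ pos x with hR
  obtain ⟨PR, hPRcard, hPR⟩ := hrep R (Finset.filter_subset _ _)
  have hptR : ∀ q, q * g < n → pt (q * g) ∈ R := fun q hq =>
    Finset.mem_filter.2 ⟨(hpt _ hq).1, by rw [(hpt _ hq).2]; exact Dvd.intro_left q rfl⟩
  let star : Finset (α × α) := V.image fun x => (x, pt (pos x / g * g))
  let star' : Finset (α × α) := V.image fun x => (x, pt ((pos x / g + 1) * g))
  let inner : Finset (α × α) := (Finset.range n).biUnion local'
  refine ⟨inner ∪ (star ∪ star') ∪ PR, ?_, fun T hT => ?_⟩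
  · have h1 : inner.card ≤ 2 * K * n := by
      have hb : ∀ q, (block q).card ≤ (V.filter fun x => pos x / g = q).card +
          (V.filter fun x => pos x / g = q + 1).card := fun q => by
        simp only [block, Finset.filter_or]
        exact Finset.card_union_le _ _
      calc inner.card ≤ ∑ q ∈ Finset.range n, (local' q).card := Finset.card_biUnion_le
        _ ≤ ∑ q ∈ Finset.range n, K * ((V.filter fun x => pos x / g = q).card +
            (V.filter fun x => pos x / g = q + 1).card) :=
          Finset.sum_le_sum fun q _ => (hlocal_card q).trans (Nat.mul_le_mul_left K (hb q))
        _ ≤ K * (n + n) := by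
          rw [← Finset.mul_sum, Finset.sum_add_distrib]
          exact Nat.mul_le_mul_left K (add_le_add
            (sum_card_fiber_le V _ Function.injective_id _)
            (sum_card_fiber_le V _ (add_left_injective 1) _))
        _ = 2 * K * n := by ring
    have h2 : (star ∪ star').card ≤ 2 * n :=
      (Finset.card_union_le _ _).trans
        ((add_le_add Finset.card_image_le Finset.card_image_le).trans_eq (two_mul n).symm)
    have h3 : (PR.card : ℝ) ≤ C * n := by
      have hRc : R.card ≤ (n - 1) / g + 1 := by
        rw [← Finset.card_range ((n - 1) / g + 1)]
        refine Finset.card_le_card_of_injOn (fun x => pos x / g) (fun x hx => ?_)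
          (fun x hx y hy hxy => ?_)
        · have := hposn x (Finset.mem_filter.1 hx).1
          exact Finset.mem_coe.2 (Finset.mem_range.2
            (Nat.lt_succ_of_le (Nat.div_le_div_right (by lia))))
        · obtain ⟨hxV, hxg⟩ := Finset.mem_filter.1 hx
          obtain ⟨hyV, hyg⟩ := Finset.mem_filter.1 hy
          refine hpos.injOn hxV hyV ?_
          rw [← Nat.div_mul_cancel hxg, ← Nat.div_mul_cancel hyg]
          exact congrArg (· * g) hxy
      have hRg : (R.card - 1) * g ≤ n :=
        ((Nat.mul_le_mul_right g (by lia)).trans (hdiv (n - 1))).trans (by lia)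
      refine hPRcard.trans (mul_le_mul_of_nonneg_left ?_ hC)
      calc ((R.card - 1 : ℕ) : ℝ) * σ ≤ ((R.card - 1 : ℕ) : ℝ) * g := by gcongr
        _ ≤ n := by exact_mod_cast hRg
    have h4 : (inner ∪ (star ∪ star') ∪ PR).card ≤ 2 * K * n + 2 * n + PR.card :=
      (Finset.card_union_le _ _).trans (Nat.add_le_add_right
        ((Finset.card_union_le _ _).trans (add_le_add h1 h2)) _)
    calc ((inner ∪ (star ∪ star') ∪ PR).card : ℝ) ≤ 2 * K * n + 2 * n + PR.card := by
          exact_mod_cast h4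
      _ ≤ (2 * K + 2 + C) * n := by linarith
  · have hTR : T.image (fun x => pt (pos x / g * g)) ⊆ R := fun r hr => by
      obtain ⟨x, hx, rfl⟩ := Finset.mem_image.1 hr
      exact hptR _ ((hdiv _).trans_lt (hposn x (hT hx)))
    obtain ⟨U, hTU, hUF, hU⟩ := hPR _ hTR T.card Finset.card_image_le (Finset.card_le_card hT)
    have hfault : ∀ z ∈ T, pt (pos z / g * g) ∈ U := fun z hz =>
      hTU (Finset.mem_image_of_mem (fun x => pt (pos x / g * g)) hz)
    refine ⟨U.biUnion fun r => V.filter fun x => pos x / g = pos r / g ∨ pos x / g + 1 = pos r / g,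
      ?_, fun x hx hxU y hy hyU hsep => ?_⟩
    · have hgroup : ∀ q, (V.filter fun x => pos x / g = q).card ≤ g := fun q => by
        calc _ ≤ (Finset.Ico (q * g) (q * g + g)).card := by
              refine Finset.card_le_card_of_injOn pos (fun x hx => ?_)
                (hpos.injOn.mono (Finset.coe_subset.2 (Finset.filter_subset _ _)))
              obtain ⟨-, hq⟩ := Finset.mem_filter.1 hx
              rw [Finset.coe_Ico, Set.mem_Ico]
              have := (Nat.div_eq_iff hg).1 hq
              lia
          _ = g := by simp
      have hkill : ∀ r ∈ U, (V.filter fun x =>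
          pos x / g = pos r / g ∨ pos x / g + 1 = pos r / g).card ≤ 2 * g := fun r _ => by
        rw [Finset.filter_or, two_mul]
        refine (Finset.card_union_le _ _).trans (add_le_add (hgroup _) ?_)
        refine le_trans (Finset.card_le_card fun x hx => ?_) (hgroup (pos r / g - 1))
        obtain ⟨hxV, hxq⟩ := Finset.mem_filter.1 hx
        exact Finset.mem_filter.2 ⟨hxV, by lia⟩
      have := Finset.card_biUnion_le_card_mul U _ _ hkill
      calc _ ≤ (U.card : ℝ) * (2 * g) := by exact_mod_cast this
        _ ≤ F T.card * (2 * g) := by gcongr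
        _ = _ := by ring
    · have hown : ∀ z ∈ V, z ∉ (U.biUnion fun r =>
          V.filter fun x => pos x / g = pos r / g ∨ pos x / g + 1 = pos r / g) →
          pt (pos z / g * g) ∉ U := fun z hz hzU h => hzU <| by
        refine Finset.mem_biUnion.2 ⟨_, h, Finset.mem_filter.2 ⟨hz, .inl ?_⟩⟩
        rw [(hpt _ ((hdiv _).trans_lt (hposn z hz))).2, Nat.mul_div_cancel _ hg]
      have hxown := hown x hx hxU
      have hyown := hown y hy hyU
      have hxnext : (pos x / g + 1) * g < n → pt ((pos x / g + 1) * g) ∉ U := fun hlt h => hxU <| by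
        refine Finset.mem_biUnion.2 ⟨_, h, Finset.mem_filter.2 ⟨hx, .inr ?_⟩⟩
        rw [(hpt _ hlt).2, Nat.mul_div_cancel _ hg]
      have hab : pos x / g ≤ pos y / g := Nat.div_le_div_right hsep.1.le
      rcases le_or_gt (pos y / g) (pos x / g + 1) with hclose | hfar
      · refine (hlocal_joined (pos x / g) x (Finset.mem_filter.2 ⟨hx, .inl rfl⟩) y
          (Finset.mem_filter.2 ⟨hy, by lia⟩)).mono ?_ ?_
        · refine Finset.coe_subset.2 (((Finset.subset_biUnion_of_mem local'
            (Finset.mem_range.2 ((Nat.div_le_self _ _).trans_lt (hposn x hx)))).trans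
            Finset.subset_union_left).trans Finset.subset_union_left)
        · intro z hz
          obtain ⟨hzV, hzq⟩ := Finset.mem_filter.1 (Finset.mem_coe.1 hz)
          refine ⟨hzV, fun hzT => ?_⟩
          have hzU := hfault z hzT
          rcases hzq with hzq | hzq <;> rw [hzq] at hzU
          · exact hxown hzU
          · exact hxnext (hzq ▸ (hdiv _).trans_lt (hposn z hzV)) hzU
      · have hr2 : pos y / g * g < n := (hdiv _).trans_lt (hposn y hy)
        have hr12 : (pos x / g + 1) * g ≤ pos y / g * g := Nat.mul_le_mul_right g hfar.le
        have hr1 : (pos x / g + 1) * g < n := hr12.trans_lt hr2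
        have hRT : (R \ T.image (fun x => pt (pos x / g * g)) : Set α) ⊆ (V \ T : Set α) := by
          rintro z ⟨hzR, hzT⟩
          obtain ⟨hzV, hzg⟩ := Finset.mem_filter.1 (Finset.mem_coe.1 hzR)
          refine ⟨hzV, fun hz => hzT (Finset.mem_coe.2 (Finset.mem_image.2 ⟨z, hz, ?_⟩))⟩
          rw [Nat.div_mul_cancel hzg]
          obtain ⟨h1, h2⟩ := hpt _ (hposn z hzV)
          exact hpos.injOn h1 hzV h2
        have hmem : ∀ r ∈ R, r ∉ U → r ∈ (V \ T : Set α) := fun r hr hrU =>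
          hRT ⟨hr, fun h => hrU (hTU h)⟩
        have hnot : ∀ z ∈ V, pt (pos z / g * g) ∉ U → z ∈ (V \ T : Set α) := fun z hz hzU =>
          ⟨hz, fun hzT => hzU (hfault z hzT)⟩
        have h12 := (hU _ (hptR _ hr1) (hxnext hr1) _ (hptR _ hr2) hyown).mono
          (Q := ((inner ∪ (star ∪ star') ∪ PR : Finset _) : Set _))
          (Finset.coe_subset.2 Finset.subset_union_right) hRT
        have hx1 : Joined ((inner ∪ (star ∪ star') ∪ PR : Finset _) : Set _)
            (V \ T : Set α) x _ _ :=
          .single (.inl (Finset.mem_coe.2 (Finset.mem_union_left _ (Finset.mem_union_right _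
            (Finset.mem_union_right _ (Finset.mem_image_of_mem _ hx))))))
            (hnot x hx hxown) (hmem _ (hptR _ hr1) (hxnext hr1))
        have h2y : Joined ((inner ∪ (star ∪ star') ∪ PR : Finset _) : Set _)
            (V \ T : Set α) _ y _ :=
          .single (.inr (Finset.mem_coe.2 (Finset.mem_union_left _ (Finset.mem_union_right _
            (Finset.mem_union_left _ (Finset.mem_image_of_mem _ hy))))))
            (hmem _ (hptR _ hr2) hyown) (hnot y hy hyown)
        refine ((hx1.trans h12).trans h2y).mono_length ?_
        obtain ⟨h1V, h1pos⟩ := hpt _ hr1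
        obtain ⟨h2V, h2pos⟩ := hpt _ hr2
        refine hsep.2 _ h1V _ h2V ?_ ?_ ?_
        · rw [h1pos, mul_comm]
          exact (Nat.lt_mul_div_succ _ hg).le
        · rw [h1pos, h2pos]
          exact hr12
        · rw [h2pos]
          exact hdiv _

end Groups

end HardySpanner

open HardySpanner

theorem mainTheorem6 (d : ℕ) (hd : 1 ≤ d) (t₀ t : ℝ) (ht₀ : 1 ≤ t₀) (ht : t₀ ≤ t)
    (hlt : d ≠ 1 → t₀ < t)
    (f : ℕ → ℕ → ℝ) (s : ℕ → ℝ) (hs : ∀ n, 1 ≤ s n)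
    (h : HardySpannersExist d t₀ f (fun n => n * s n)) :
    ∃ c : ℝ, 0 < c ∧ HardySpannersExist d t (fun k n => c * (f k n * s n)) (fun n => n) := by
  classical
  obtain ⟨ι, _, hord⟩ := exists_orders ht₀ ht hlt
  obtain ⟨K, hlocal⟩ := exists_linear_spanner (d := d) (ht₀.trans ht) fun h => ht₀.trans_lt (hlt h)
  obtain ⟨C, hC, hrep⟩ := exists_pairs_of_card_le hd (by linarith) hs h
  set m := Fintype.card ι with hm
  -- Besides the faults themselves, at most `f(k,n)` many, each of the `m` orders gives up at most
  -- `2 g f(k,n) ≤ 4 f(k,n) s(n)` points.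
  refine ⟨1 + 4 * m, by positivity, m * (2 * K + 2 + C) + 1, by positivity, fun V => ?_⟩
  obtain ⟨pos, hpos, hsep⟩ := hord V
  set n := V.card with hn
  set g := ⌈s n⌉₊ with hg
  have hsn := hs n
  have hsg : s n ≤ g := Nat.le_ceil _
  have hgs : (g : ℝ) ≤ 2 * s n := by linarith [Nat.ceil_lt_add_one (zero_le_one.trans hsn)]
  choose P hPcard hP using fun i => exists_pairs_of_position (hpos i)
    (Nat.ceil_pos.2 (zero_lt_one.trans_le hsn)) hC.le hsg hlocal
    (fun R hR => hrep n R (Finset.card_le_card hR))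
  refine ⟨graphOfPairs V (Finset.univ.biUnion P), ?_, isHardySpanner_graphOfPairs fun T hT => ?_⟩
  · calc ((graphOfPairs V (Finset.univ.biUnion P)).edgeSet.ncard : ℝ)
        ≤ ((Finset.univ.biUnion P).card : ℝ) := by
          exact_mod_cast ncard_edgeSet_graphOfPairs_le _ _
      _ ≤ ∑ i, ((P i).card : ℝ) := by exact_mod_cast Finset.card_biUnion_le
      _ ≤ ∑ _i : ι, (2 * K + 2 + C) * (n : ℝ) := Finset.sum_le_sum fun i _ => hPcard i
      _ = m * (2 * K + 2 + C) * n := by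
          rw [Finset.sum_const, Finset.card_univ, nsmul_eq_mul, mul_assoc]
      _ ≤ _ := by gcongr; linarith
  · choose U hUcard hU using fun i => hP i T hT
    obtain ⟨_, -, hV⟩ := hrep n V le_rfl
    obtain ⟨T', hTT', hT', -⟩ := hV T hT T.card le_rfl (Finset.card_le_card hT)
    have hfT : (T.card : ℝ) ≤ f T.card n :=
      le_trans (by exact_mod_cast Finset.card_le_card hTT') hT'
    have hf0 : 0 ≤ f T.card n := le_trans (by positivity) hfT
    refine ⟨T ∪ Finset.univ.biUnion U, Finset.subset_union_left, ?_, fun x hx hxT y hy hyT => ?_⟩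
    · calc ((T ∪ Finset.univ.biUnion U).card : ℝ) ≤ T.card + ∑ i, ((U i).card : ℝ) := by
            exact_mod_cast (Finset.card_union_le _ _).trans
              (Nat.add_le_add_left Finset.card_biUnion_le _)
        _ ≤ f T.card n * s n + ∑ _i : ι, 4 * (f T.card n * s n) := by
            refine add_le_add (hfT.trans (le_mul_of_one_le_right hf0 hsn))
              (Finset.sum_le_sum fun i _ => (hUcard i).trans ?_)
            calc 2 * g * f T.card n ≤ 2 * (2 * s n) * f T.card n := by gcongr
              _ = _ := by ring
        _ = _ := by
            rw [Finset.sum_const, Finset.card_univ, nsmul_eq_mul]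
            ring
    · rcases eq_or_ne x y with rfl | hxy
      · exact .refl _ (by simp)
      have hout : ∀ z, z ∉ T ∪ Finset.univ.biUnion U → ∀ i, z ∉ U i := fun z hz i hi =>
        hz (Finset.mem_union_right _ (Finset.mem_biUnion.2 ⟨i, Finset.mem_univ _, hi⟩))
      obtain ⟨i, hi⟩ := hsep x hx y hy hxy
      have hPi : (P i : Set (EuclideanSpace ℝ (Fin d) × EuclideanSpace ℝ (Fin d))) ⊆
          (Finset.univ.biUnion P : Finset _) :=
        Finset.coe_subset.2 (Finset.subset_biUnion_of_mem P (Finset.mem_univ i))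
      rcases hi with hi | hi
      · exact (hU i x hx (hout x hxT i) y hy (hout y hyT i) hi).mono hPi le_rfl
      · rw [dist_comm]
        exact (hU i y hy (hout y hyT i) x hx (hout x hxT i) hi).symm.mono hPi le_rfl
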